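/- For $j\ge 0$ let $h_j=\mathrm{He}_j/\sqrt{j!}$ be the $j$-th (probabilists') Hermite polynomial normalized to have norm $1$ in $L^2(\mathcal N(0,1))$. For a multiset $I$ of elements of $[n]$, in which $k$ has multiplicity $I_k$, let $|I|=\sum_k I_k$ and $h_I(x_1,\dots,x_n)=\prod_{k=1}^n h_{I_k}(x_k)$. The polynomials $h_I$ form a basis of the space of real polynomials in $n$ variables. Fix $d$. Let $Q$ be the matrix with rows indexed by the multisets $J$ with $|J|\le 2d$ and columns indexed by the pairs $(I,I')$ with $0<|I|,|I'|\le d$, whose entry $Q_{J(I,I')}$ is the coefficient of $h_J$ in the expansion of $h_I h_{I'}$ in this basis. For points $p_1,\dots,p_m\in\mathbb R^n$ let $H$ be the matrix with rows indexed by the $I$ with $0<|I|\le d$, columns indexed by $i\in[m]$, and entries $H_{Ii}=h_I(p_i)$. **Theorem.** For every $d\ge 0$ there are constants $C_d\in\mathbb R$ and $k_d\in\mathbb N$, depending only on $d$, such that for all real $\delta>0$ and $\beta>0$ there is an $N$ such that the following holds for all $n\ge N$ and all integers $m\ge 0$ with $m\le n^{d/2-\delta}$. If $p_1,\dots,p_m$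 are independent samples from the standard normal distribution $\mathcal N(0,\mathrm{Id})$ on $\mathbb R^n$, then with probability at least $1-n^{-\beta}$, $$\|Q(H\otimes H)(x\otimes x)\|^2\;\le\; C_d\,(\log n)^{k_d}\,n^{2d}\,\|x\|^4\qquad\text{for all } x\in\mathbb R^m,$$ where the norms are Euclidean. That is, with high probability $\|Q(H\otimes H)(x\otimes x)\|^2$ is $\tilde O(n^{2d}\|x\|^4)$ for all $x$ simultaneously. -/

import Mathlib

open MeasureTheory ProbabilityTheory
open scoped Kronecker

noncomputable section

/-- The `j`-th Hermite polynomial normalized to have norm one in `L²(N(0,1))`, that is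
`He_j / √(j!)` with `He_j` the probabilists' Hermite polynomial. -/
def hermiteNormalized (j : ℕ) : Polynomial ℝ :=
  Polynomial.C (1 / Real.sqrt (j.factorial : ℝ)) *
    (Polynomial.hermite j).map (Int.castRingHom ℝ)

/-- `h_I(x₁,…,xₙ) = ∏ₖ h_{I_k}(xₖ)`. A multiset `I` of elements of `[n]` is given by its
multiplicities `I : Fin n →₀ ℕ`, and `I.degree` is its cardinality `|I|`. -/
def hermiteMv {n : ℕ} (I : Fin n →₀ ℕ) : MvPolynomial (Fin n) ℝ :=
  ∏ k, Polynomial.aeval (MvPolynomial.X k) (hermiteNormalized (I k))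

theorem hermiteNormalized_degree (j : ℕ) : (hermiteNormalized j).degree = j := by
  have h1 : (1 / Real.sqrt (j.factorial : ℝ)) ≠ 0 := by positivity
  rw [hermiteNormalized, Polynomial.degree_C_mul h1,
    (Polynomial.hermite_monic j).degree_map, Polynomial.degree_hermite]

def hermiteSequence : Polynomial.Sequence ℝ where
  elems' := hermiteNormalized
  degree_eq' := hermiteNormalized_degree

/-- The normalized Hermite polynomials as a basis of `ℝ[X]`. -/
def hermiteBasisOne : Module.Basis ℕ ℝ (Polynomial ℝ) :=
  hermiteSequence.basis fun j => by
    rw [isUnit_iff_ne_zero, Polynomial.leadingCoeff_ne_zero]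
    exact hermiteSequence.ne_zero j

theorem hermiteBasisOne_apply (j : ℕ) : hermiteBasisOne j = hermiteNormalized j := by
  simp [hermiteBasisOne]
  rfl

/-- `(f₁,…,fₙ) ↦ ∏ₖ fₖ(xₖ)` as a multilinear map. -/
def separableProduct (n : ℕ) :
    MultilinearMap ℝ (fun _ : Fin n => Polynomial ℝ) (MvPolynomial (Fin n) ℝ) :=
  (MultilinearMap.mkPiAlgebra ℝ (Fin n) (MvPolynomial (Fin n) ℝ)).compLinearMap
    fun k => (Polynomial.aeval (MvPolynomial.X k)).toLinearMap

theorem separableProduct_apply {n : ℕ} (f : Fin n → Polynomial ℝ) :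
    separableProduct n f = ∏ k, Polynomial.aeval (MvPolynomial.X k) (f k) := by
  simp [separableProduct]

theorem separableProduct_hermite {n : ℕ} (I : Fin n →₀ ℕ) :
    separableProduct n (fun k => hermiteBasisOne (I k)) = hermiteMv I := by
  simp only [separableProduct_apply, hermiteBasisOne_apply, hermiteMv]

theorem separableProduct_X_pow {n : ℕ} (I : Fin n →₀ ℕ) :
    separableProduct n (fun k => Polynomial.X ^ (I k)) = MvPolynomial.monomial I 1 := by
  rw [separableProduct_apply, MvPolynomial.monomial_eq]
  simp [Finsupp.prod_fintype]

theorem hermiteMv_linearIndependent (n : ℕ) :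
    LinearIndependent ℝ (hermiteMv : (Fin n →₀ ℕ) → MvPolynomial (Fin n) ℝ) := by
  classical
  let ψ : (Fin n →₀ ℕ) → MvPolynomial (Fin n) ℝ →ₗ[ℝ] ℝ := fun J =>
    (MvPolynomial.basisMonomials (Fin n) ℝ).constr ℝ
      fun I => ∏ k, hermiteBasisOne.coord (J k) (Polynomial.X ^ (I k))
  have key : ∀ (J : Fin n →₀ ℕ), (ψ J).compMultilinearMap (separableProduct n) =
      (MultilinearMap.mkPiAlgebra ℝ (Fin n) ℝ).compLinearMap
        fun k => hermiteBasisOne.coord (J k) := by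
    intro J
    refine Module.Basis.ext_multilinear (fun _ => Polynomial.basisMonomials ℝ) fun v => ?_
    have h2 := separableProduct_X_pow (Finsupp.equivFunOnFinite.symm v)
    simp only [Finsupp.equivFunOnFinite_symm_apply_apply] at h2
    simp only [Polynomial.coe_basisMonomials, Polynomial.monomial_one_right_eq_X_pow,
      LinearMap.compMultilinearMap_apply, h2, MultilinearMap.compLinearMap_apply,
      MultilinearMap.mkPiAlgebra_apply]
    rw [show MvPolynomial.monomial (Finsupp.equivFunOnFinite.symm v) (1 : ℝ) =
      MvPolynomial.basisMonomials (Fin n) ℝ (Finsupp.equivFunOnFinite.symm v) by simp]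
    simp only [ψ, Module.Basis.constr_basis, Finsupp.equivFunOnFinite_symm_apply_apply]
  have hδ : ∀ J I : Fin n →₀ ℕ, ψ J (hermiteMv I) = if I = J then 1 else 0 := by
    intro J I
    have h3 := congrArg (fun M => M fun k => hermiteBasisOne (I k)) (key J)
    simp only [LinearMap.compMultilinearMap_apply, separableProduct_hermite,
      MultilinearMap.compLinearMap_apply, MultilinearMap.mkPiAlgebra_apply] at h3
    rw [h3]
    split_ifs with h
    · subst h; simp
    · obtain ⟨k, hk⟩ := Finsupp.ne_iff.mp h
      exact Finset.prod_eq_zero (Finset.mem_univ k) (by simp [hk])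
  rw [linearIndependent_iff']
  intro s g hg J hJ
  have h4 := congrArg (ψ J) hg
  simpa [hδ, hJ] using h4

theorem hermiteMv_span (n : ℕ) :
    ⊤ ≤ Submodule.span ℝ
      (Set.range (hermiteMv : (Fin n →₀ ℕ) → MvPolynomial (Fin n) ℝ)) := by
  set S := Submodule.span ℝ
    (Set.range (hermiteMv : (Fin n →₀ ℕ) → MvPolynomial (Fin n) ℝ)) with hS
  have h0 : S.mkQ.compMultilinearMap (separableProduct n) = 0 := by
    refine Module.Basis.ext_multilinear (fun _ => hermiteBasisOne) fun v => ?_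
    have h2 := separableProduct_hermite (Finsupp.equivFunOnFinite.symm v)
    simp only [Finsupp.equivFunOnFinite_symm_apply_apply] at h2
    simp only [LinearMap.compMultilinearMap_apply, h2, _root_.zero_apply,
      Submodule.mkQ_apply, Submodule.Quotient.mk_eq_zero]
    exact Submodule.subset_span ⟨_, rfl⟩
  rw [← (MvPolynomial.basisMonomials (Fin n) ℝ).span_eq, Submodule.span_le]
  rintro _ ⟨I, rfl⟩
  have h1 := congrArg (fun M => M fun k => Polynomial.X ^ (I k)) h0
  simpa [separableProduct_X_pow] using h1

/-- The polynomials `h_I` as a basis of the space of polynomials in `n` variables. -/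
def hermiteBasis (n : ℕ) : Module.Basis (Fin n →₀ ℕ) ℝ (MvPolynomial (Fin n) ℝ) :=
  Module.Basis.mk (hermiteMv_linearIndependent n) (hermiteMv_span n)

/-- The multisets `I` of elements of `[n]` with `0 < |I| ≤ d`. -/
abbrev HermiteIndex (n d : ℕ) : Type := {I : Fin n →₀ ℕ // 0 < I.degree ∧ I.degree ≤ d}

/-- The multisets `J` of elements of `[n]` with `|J| ≤ 2d`: the only ones whose `h_J` can occur
in a product `h_I h_{I'}` with `|I|, |I'| ≤ d`, because such a product has degree at most `2d`. -/
abbrev ProductIndex (n d : ℕ) : Type := {J : Fin n →₀ ℕ // J.degree ≤ 2 * d}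

instance (n d : ℕ) : Fintype (HermiteIndex n d) :=
  ((Finsupp.finite_of_degree_le d).subset fun _ h => h.2).fintype

instance (n d : ℕ) : Fintype (ProductIndex n d) :=
  (Finsupp.finite_of_degree_le (2 * d)).fintype

/-- The matrix `H` with entries `H_{I i} = h_I(p_i)`. -/
def hermiteMatrix {n m : ℕ} (d : ℕ) (p : Fin m → Fin n → ℝ) :
    Matrix (HermiteIndex n d) (Fin m) ℝ :=
  Matrix.of fun I i => MvPolynomial.eval (p i) (hermiteMv I.1)

/-- The matrix `Q`: the entry `Q_{J (I, I')}` is the coefficient of `h_J` in `h_I h_{I'}`. -/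
def linearizationMatrix (n d : ℕ) :
    Matrix (ProductIndex n d) (HermiteIndex n d × HermiteIndex n d) ℝ :=
  Matrix.of fun J II => (hermiteBasis n).repr (hermiteMv II.1.1 * hermiteMv II.2.1) J.1

/-- The vector `x ⊗ x`. -/
def tensorSquare {m : ℕ} (x : EuclideanSpace ℝ (Fin m)) : Fin m × Fin m → ℝ :=
  fun jj => x jj.1 * x jj.2

/-- The law of `m` independent samples `p₁,…,p_m` from `N(0, Id)` on `ℝⁿ`. -/
def gaussianSamples (n m : ℕ) : Measure (Fin m → Fin n → ℝ) :=
  Measure.pi fun _ => Measure.pi fun _ => gaussianReal 0 1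

end

/-! Put `v = Hx` and `f = ∑ v_I h_I`. The vector `Q(H ⊗ H)(x ⊗ x)` lists the Hermite coefficients of
`f²`, so by orthonormality its squared norm is at most `E f⁴`. Gaussian hypercontractivity for
polynomials of degree at most `d` bounds this by a dimension-free constant times `(E f²)² = ‖Hx‖⁴`
(`exists_norm_sq_linearization_le`). It remains to show that `‖Hx‖²` is at most `n^d ‖x‖²` up to
logarithms.

Now `‖Hx‖²` is the quadratic form of the Gram matrix with entries `K(p_i, p_j)`, where `K(x, y) = ∑
h_I(x) h_I(y)`. If all coordinates of the samples are below `log n`, each diagonal entry is at most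
`n^d` up to logarithms, because there are at most `(n+1)^d` indices `I`. If all off-diagonal entries
are below `T = n^(d/2+δ)`, they contribute at most `m T ‖x‖² ≤ n^d ‖x‖²`; this is where the bound on
`m` enters.

Both conditions hold with high probability by a union bound. The first uses a Chernoff bound. For
the second, `K(·, y)` has degree at most `d` and second moment `K(y, y)`, so hypercontractivity
bounds its moment of order `2^(r+1)` by a multiple of `K(y, y)^(2^r)`, whose mean is of order at
most `n^(d 2^r)`. Markov's inequality at `T` then gains a factor `n^(-2δ 2^r)`, which beats any
fixed power of `n` once `r` is large (`exists_measure_hermiteKernel_ge_le`). -/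

/-! ### Orthonormality of Hermite polynomials in one variable. -/

theorem integrable_eval_gaussianReal (p : Polynomial ℝ) :
    Integrable (fun t => p.eval t) (gaussianReal 0 1) := by
  induction p using Polynomial.induction_on' with
  | add p q hp hq => exact (hp.add hq).congr (.of_forall fun t => by simp)
  | monomial k a =>
    simp only [Polynomial.eval_monomial]
    refine Integrable.const_mul ?_ a
    have h := (memLp_id_gaussianReal (μ := 0) (v := 1) k).integrable_norm_pow'
    refine h.mono (by fun_prop) ?_
    simp

/-- The expectation of a polynomial under the standard normal distribution. -/
noncomputable def gaussianExp : Polynomial ℝ →ₗ[ℝ] ℝ where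
  toFun p := ∫ t, p.eval t ∂(gaussianReal 0 1)
  map_add' p q := by
    simp only [Polynomial.eval_add]
    exact integral_add (integrable_eval_gaussianReal p) (integrable_eval_gaussianReal q)
  map_smul' c p := by simp [integral_const_mul]

theorem gaussianExp_apply (p : Polynomial ℝ) :
    gaussianExp p = ∫ t, p.eval t ∂(gaussianReal 0 1) := rfl

theorem gaussianExp_C (a : ℝ) : gaussianExp (Polynomial.C a) = a := by
  simp [gaussianExp_apply]

/-- Gaussian integration by parts: the density `φ` satisfies `φ' = -tφ`, so `φ (p' - X p)` is the
derivative of `φ p`. Both functions are integrable on the line, hence the integral of the derivative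
vanishes. -/
theorem gaussianExp_X_mul (p : Polynomial ℝ) :
    gaussianExp (Polynomial.X * p) = gaussianExp (Polynomial.derivative p) := by
  have hint : ∀ q : Polynomial ℝ, Integrable fun t => gaussianPDFReal 0 1 t * q.eval t := by
    intro q
    have h := integrable_eval_gaussianReal q
    rw [gaussianReal_of_var_ne_zero 0 one_ne_zero,
      integrable_withDensity_iff_integrable_smul' (measurable_gaussianPDF 0 1)
        (by simp [gaussianPDF_lt_top])] at h
    simpa [toReal_gaussianPDF] using h
  have hder : ∀ t : ℝ, HasDerivAt (fun t => gaussianPDFReal 0 1 t * p.eval t)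
      (gaussianPDFReal 0 1 t * (Polynomial.derivative p - Polynomial.X * p).eval t) t := by
    intro t
    have h1 : HasDerivAt (gaussianPDFReal 0 1) (-t * gaussianPDFReal 0 1 t) t := by
      have h3 : HasDerivAt (fun t : ℝ => -(t ^ 2) / 2) (-t) t := by
        have := ((hasDerivAt_pow 2 t).neg).div_const 2
        refine this.congr_deriv ?_
        norm_num
        ring
      have h4 := (h3.exp).const_mul ((Real.sqrt (2 * Real.pi))⁻¹)
      have h5 : gaussianPDFReal 0 1 =
          fun t => (Real.sqrt (2 * Real.pi))⁻¹ * Real.exp (-(t ^ 2) / 2) := by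
        ext t; simp [gaussianPDFReal]
      rw [h5]
      refine h4.congr_deriv ?_
      ring
    refine (h1.mul (p.hasDerivAt t)).congr_deriv ?_
    simp
    ring
  have h0 := integral_eq_zero_of_hasDerivAt_of_integrable hder (hint _) (hint _)
  have h6 : gaussianExp (Polynomial.derivative p - Polynomial.X * p) = 0 := by
    rw [gaussianExp_apply, integral_gaussianReal_eq_integral_smul one_ne_zero]
    simpa using h0
  rw [map_sub] at h6
  linarith

/-- In the recursion `He_{j+1} = X He_j - He_j'`, integrating the first term by parts cancels the
second and leaves `He_j p'`. -/
theorem gaussianExp_hermite_mul (j : ℕ) (p : Polynomial ℝ) :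
    gaussianExp ((Polynomial.hermite j).map (Int.castRingHom ℝ) * p) =
      gaussianExp (Polynomial.derivative^[j] p) := by
  induction j generalizing p with
  | zero => simp
  | succ j ih =>
    rw [Polynomial.hermite_succ, Function.iterate_succ_apply, ← ih]
    rw [Polynomial.map_sub, Polynomial.map_mul, Polynomial.map_X, sub_mul, map_sub, mul_assoc,
      gaussianExp_X_mul, Polynomial.derivative_mul, map_add, Polynomial.derivative_map]
    ring

theorem gaussianExp_hermiteNormalized_mul (i j : ℕ) :
    gaussianExp (hermiteNormalized i * hermiteNormalized j) = if i = j then 1 else 0 := by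
  wlog hij : j ≤ i generalizing i j
  · rw [mul_comm, this j i (by omega)]
    simp [eq_comm]
  set He := fun k => (Polynomial.hermite k).map (Int.castRingHom ℝ) with hHe
  have hmon : ∀ k, (He k).Monic := fun k => (Polynomial.hermite_monic k).map _
  have hdeg : ∀ k, (He k).natDegree = k := fun k => by
    rw [hHe]
    simp only [(Polynomial.hermite_monic k).natDegree_map, Polynomial.natDegree_hermite]
  have h1 : hermiteNormalized i * hermiteNormalized j =
      (1 / Real.sqrt (i.factorial : ℝ) * (1 / Real.sqrt (j.factorial : ℝ))) • (He i * He j) := by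
    rw [hermiteNormalized, hermiteNormalized, Polynomial.smul_eq_C_mul, map_mul]
    ring
  rw [h1, map_smul, gaussianExp_hermite_mul]
  split_ifs with h
  · subst h
    have h2 : Polynomial.derivative^[i] (He i) = Polynomial.C (i.factorial : ℝ) := by
      have h3 : (Polynomial.derivative^[i] (He i)).natDegree = 0 := by
        have := Polynomial.natDegree_iterate_derivative (He i) i
        rw [hdeg] at this
        omega
      rw [Polynomial.eq_C_of_natDegree_eq_zero h3, Polynomial.coeff_iterate_derivative]
      have := (hmon i).coeff_natDegree
      rw [hdeg] at this
      simp [this, Nat.descFactorial_self]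
    rw [h2, gaussianExp_C, smul_eq_mul, div_mul_div_comm, one_mul, Real.mul_self_sqrt (by positivity)]
    exact one_div_mul_cancel (by positivity)
  · rw [Polynomial.iterate_derivative_eq_zero (by rw [hdeg]; omega)]
    simp

theorem hermiteNormalized_zero : hermiteNormalized 0 = 1 := by
  simp [hermiteNormalized]

theorem gaussianExp_hermiteNormalized {j : ℕ} (hj : j ≠ 0) :
    gaussianExp (hermiteNormalized j) = 0 := by
  have := gaussianExp_hermiteNormalized_mul j 0
  simpa [hermiteNormalized_zero, hj] using this

theorem X_pow_mem_span_hermiteNormalized (b : ℕ) :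
    ∃ c : ℕ → ℝ, (Polynomial.X : Polynomial ℝ) ^ b =
      ∑ a ∈ Finset.range (b + 1), c a • hermiteNormalized a := by
  have h1 := hermiteSequence.span_degreeLE (m := b) fun i _ => by
    rw [isUnit_iff_ne_zero, Polynomial.leadingCoeff_ne_zero]
    exact hermiteSequence.ne_zero i
  have h2 : (Polynomial.X : Polynomial ℝ) ^ b ∈ Polynomial.degreeLE ℝ b := by
    rw [Polynomial.mem_degreeLE]
    exact Polynomial.degree_X_pow_le b
  rw [← h1, ← Finset.coe_Iic, Submodule.mem_span_image_finset_iff_exists_fun'] at h2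
  obtain ⟨c, hc⟩ := h2
  refine ⟨c, ?_⟩
  rw [← hc, Nat.range_succ_eq_Iic]
  rfl

/-! ### Gaussian expectation and orthonormality in `n` variables. -/

theorem integrable_eval_gaussian {n : ℕ} (p : MvPolynomial (Fin n) ℝ) :
    Integrable (fun x => MvPolynomial.eval x p) (Measure.pi fun _ => gaussianReal 0 1) := by
  induction p using MvPolynomial.induction_on' with
  | add p q hp hq => exact (hp.add hq).congr (.of_forall fun t => by simp)
  | monomial I a =>
    simp only [MvPolynomial.eval_monomial, Finsupp.prod_pow]
    refine Integrable.const_mul ?_ a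
    refine Integrable.fintype_prod (f := fun k t => t ^ I k) fun k => ?_
    simpa using integrable_eval_gaussianReal (Polynomial.X ^ I k)

/-- The expectation of a polynomial under the standard normal distribution on `ℝⁿ`. -/
noncomputable def gaussianExpMv (n : ℕ) : MvPolynomial (Fin n) ℝ →ₗ[ℝ] ℝ where
  toFun p := ∫ x, MvPolynomial.eval x p ∂(Measure.pi fun _ => gaussianReal 0 1)
  map_add' p q := by
    simp only [map_add]
    exact integral_add (integrable_eval_gaussian p) (integrable_eval_gaussian q)
  map_smul' c p := by simp [integral_const_mul]

theorem gaussianExpMv_apply {n : ℕ} (p : MvPolynomial (Fin n) ℝ) :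
    gaussianExpMv n p =
      ∫ x, MvPolynomial.eval x p ∂(Measure.pi fun _ => gaussianReal 0 1) := rfl

theorem gaussianExpMv_C {n : ℕ} (a : ℝ) : gaussianExpMv n (MvPolynomial.C a) = a := by
  simp [gaussianExpMv_apply]

theorem gaussianExpMv_mono {n : ℕ} {p q : MvPolynomial (Fin n) ℝ}
    (h : ∀ x, MvPolynomial.eval x p ≤ MvPolynomial.eval x q) :
    gaussianExpMv n p ≤ gaussianExpMv n q :=
  integral_mono (integrable_eval_gaussian p) (integrable_eval_gaussian q) h

theorem gaussianExpMv_nonneg {n : ℕ} {p : MvPolynomial (Fin n) ℝ}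
    (h : ∀ x, 0 ≤ MvPolynomial.eval x p) : 0 ≤ gaussianExpMv n p :=
  integral_nonneg h

theorem gaussianExpMv_mul_sq_le {n : ℕ} (p q : MvPolynomial (Fin n) ℝ) :
    gaussianExpMv n (p * q) ^ 2 ≤ gaussianExpMv n (p ^ 2) * gaussianExpMv n (q ^ 2) := by
  have h : ∀ t : ℝ, 0 ≤ gaussianExpMv n (q ^ 2) * (t * t) +
      2 * gaussianExpMv n (p * q) * t + gaussianExpMv n (p ^ 2) := by
    intro t
    have h1 : 0 ≤ gaussianExpMv n ((p + t • q) ^ 2) :=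
      gaussianExpMv_nonneg fun x => by rw [map_pow]; positivity
    have h2 : (p + t • q) ^ 2 = p ^ 2 + (2 * t) • (p * q) + (t * t) • q ^ 2 := by
      simp only [MvPolynomial.smul_eq_C_mul, map_mul, map_ofNat]
      ring
    rw [h2] at h1
    simp only [map_add, map_smul, smul_eq_mul] at h1
    linarith
  have h3 := discrim_le_zero h
  rw [discrim] at h3
  linarith

theorem gaussianExpMv_mul_le {n : ℕ} {p q : MvPolynomial (Fin n) ℝ} {P R : ℝ}
    (hP : 0 ≤ P) (hR : 0 ≤ R) (hp : gaussianExpMv n (p ^ 2) ≤ P ^ 2)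
    (hq : gaussianExpMv n (q ^ 2) ≤ R ^ 2) : gaussianExpMv n (p * q) ≤ P * R := by
  refine le_of_sq_le_sq ?_ (by positivity)
  calc gaussianExpMv n (p * q) ^ 2 ≤ gaussianExpMv n (p ^ 2) * gaussianExpMv n (q ^ 2) :=
        gaussianExpMv_mul_sq_le p q
    _ ≤ P ^ 2 * R ^ 2 := mul_le_mul hp hq
        (gaussianExpMv_nonneg fun x => by rw [map_pow]; positivity) (by positivity)
    _ = (P * R) ^ 2 := by ring

theorem eval_aeval_X {n : ℕ} (x : Fin n → ℝ) (k : Fin n) (u : Polynomial ℝ) :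
    MvPolynomial.eval x (Polynomial.aeval (MvPolynomial.X k) u) = u.eval (x k) := by
  rw [← MvPolynomial.coe_aeval_eq_eval, RingHom.coe_coe, ← Polynomial.aeval_algHom_apply]
  simp

theorem gaussianExpMv_mul_rename {n : ℕ} (u : Polynomial ℝ) (q : MvPolynomial (Fin n) ℝ) :
    gaussianExpMv (n + 1) (Polynomial.aeval (MvPolynomial.X 0) u *
      MvPolynomial.rename Fin.succ q) = gaussianExp u * gaussianExpMv n q := by
  rw [gaussianExpMv_apply, gaussianExpMv_apply, gaussianExp_apply, ← integral_prod_mul,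
    ← ((measurePreserving_piFinSuccAbove (fun _ : Fin (n + 1) => gaussianReal 0 1)
      0).symm).integral_comp']
  refine integral_congr_ae (Filter.Eventually.of_forall fun x => ?_)
  simp [MvPolynomial.eval_rename, Function.comp_def, MeasurableEquiv.piFinSuccAbove_symm_apply,
    Fin.insertNthEquiv, eval_aeval_X]

theorem gaussianExpMv_hermiteMv_mul {n : ℕ} (I J : Fin n →₀ ℕ) :
    gaussianExpMv n (hermiteMv I * hermiteMv J) = if I = J then 1 else 0 := by
  have h1 : gaussianExpMv n (hermiteMv I * hermiteMv J) =
      ∏ k, gaussianExp (hermiteNormalized (I k) * hermiteNormalized (J k)) := by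
    simp only [gaussianExp_apply]
    rw [← integral_fintype_prod_eq_prod
      (f := fun k t => (hermiteNormalized (I k) * hermiteNormalized (J k)).eval t)]
    simp [gaussianExpMv_apply, hermiteMv, eval_aeval_X, Finset.prod_mul_distrib, map_prod]
  rw [h1]
  simp only [gaussianExp_hermiteNormalized_mul]
  split_ifs with h
  · simp [h]
  · obtain ⟨k, hk⟩ := Finsupp.ne_iff.mp h
    exact Finset.prod_eq_zero (Finset.mem_univ k) (by simp [hk])

theorem gaussianExpMv_sq_sum_hermiteMv {n : ℕ} {ι : Type*} {v : ι → (Fin n →₀ ℕ)}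
    (hv : Function.Injective v) (s : Finset ι) (c : ι → ℝ) :
    gaussianExpMv n ((∑ i ∈ s, c i • hermiteMv (v i)) ^ 2) = ∑ i ∈ s, c i ^ 2 := by
  classical
  rw [sq, Finset.sum_mul_sum]
  simp only [map_sum, smul_mul_smul_comm, map_smul, gaussianExpMv_hermiteMv_mul, smul_eq_mul,
    hv.eq_iff]
  refine Finset.sum_congr rfl fun I hI => ?_
  simp [Finset.sum_ite_eq, hI, sq]

/-! ### Hypercontractivity for polynomials of bounded degree. -/

/-- The change of basis from powers of `x₀` to Hermite polynomials is triangular, so `F a` collects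
only coefficients of `x₀^b` with `b ≥ a`, which have degree at most `d - a`. The range is tied to
`D` rather than `d` so that one moment constant serves every degree in the later induction. -/
theorem exists_hermite_expansion {n d D : ℕ} (hdD : d ≤ D) (f : MvPolynomial (Fin (n + 1)) ℝ)
    (hf : f.totalDegree ≤ d) :
    ∃ F : ℕ → MvPolynomial (Fin n) ℝ, (∀ a, F a = 0 ∨ (F a).totalDegree + a ≤ d) ∧
      f = ∑ a ∈ Finset.range (D + 1), Polynomial.aeval (MvPolynomial.X 0) (hermiteNormalized a) *
        MvPolynomial.rename Fin.succ (F a) := by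
  classical
  set g := MvPolynomial.finSuccEquiv ℝ n f with hg
  have hg0 : ∀ b, g.coeff b = 0 ∨ (g.coeff b).totalDegree + b ≤ d := by
    intro b
    by_cases h : g.coeff b = 0
    · exact Or.inl h
    · exact Or.inr ((MvPolynomial.totalDegree_coeff_finSuccEquiv_add_le f b h).trans hf)
  have hren : ∀ q : MvPolynomial (Fin n) ℝ, MvPolynomial.finSuccEquiv ℝ n
      (MvPolynomial.rename Fin.succ q) = Polynomial.C q := by
    intro q
    induction q using MvPolynomial.induction_on with
    | C a => simp [MvPolynomial.finSuccEquiv_apply]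
    | add p q hp hq => simp only [map_add, hp, hq]
    | mul_X p i hp => simp only [map_mul, hp, MvPolynomial.rename_X, MvPolynomial.finSuccEquiv_X_succ]
  have hfg : f = ∑ b ∈ Finset.range (D + 1),
      MvPolynomial.X 0 ^ b * MvPolynomial.rename Fin.succ (g.coeff b) := by
    apply (MvPolynomial.finSuccEquiv ℝ n).injective
    simp only [map_sum, map_mul, map_pow, MvPolynomial.finSuccEquiv_X_zero, hren]
    rw [← hg]
    have hdeg : g.natDegree < D + 1 := by
      by_contra h
      rcases hg0 g.natDegree with h0 | h0
      · have : g = 0 := by simpa using h0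
        simp [this] at h
      · omega
    nth_rewrite 1 [g.as_sum_range_C_mul_X_pow' hdeg]
    exact Finset.sum_congr rfl fun b _ => mul_comm _ _
  choose c hc using X_pow_mem_span_hermiteNormalized
  have hc' : ∀ b ∈ Finset.range (D + 1), (MvPolynomial.X 0 : MvPolynomial (Fin (n + 1)) ℝ) ^ b =
      ∑ a ∈ Finset.range (D + 1), (if a ≤ b then c b a else 0) •
        Polynomial.aeval (MvPolynomial.X 0) (hermiteNormalized a) := by
    intro b hb
    have h1 := congrArg (Polynomial.aeval (MvPolynomial.X 0 : MvPolynomial (Fin (n + 1)) ℝ)) (hc b)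
    simp only [map_pow, Polynomial.aeval_X, map_sum, map_smul] at h1
    rw [h1]
    simp only [ite_smul, zero_smul]
    rw [← Finset.sum_filter]
    refine Finset.sum_congr ?_ fun _ _ => rfl
    ext a
    simp only [Finset.mem_range, Finset.mem_filter] at hb ⊢
    omega
  refine ⟨fun a => ∑ b ∈ Finset.range (D + 1), (if a ≤ b then c b a else 0) • g.coeff b,
    fun a => ?_, ?_⟩
  · by_cases had : a ≤ d
    · right
      have : (∑ b ∈ Finset.range (D + 1), (if a ≤ b then c b a else 0) •
          g.coeff b).totalDegree ≤ d - a := by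
        refine MvPolynomial.totalDegree_finsetSum_le fun b _ => ?_
        split_ifs with hab
        · refine (MvPolynomial.totalDegree_smul_le _ _).trans ?_
          rcases hg0 b with h0 | h0
          · simp [h0]
          · omega
        · simp
      simp only
      omega
    · left
      refine Finset.sum_eq_zero fun b _ => ?_
      split_ifs with hab
      · rcases hg0 b with h0 | h0
        · simp [h0]
        · omega
      · simp
  · simp only [map_sum, map_smul, Finset.mul_sum]
    rw [Finset.sum_comm]
    nth_rewrite 1 [hfg]
    refine Finset.sum_congr rfl fun b hb => ?_
    rw [hc' b hb, Finset.sum_mul]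
    refine Finset.sum_congr rfl fun a _ => ?_
    rw [smul_mul_assoc, mul_smul_comm]

/-- Split `f = F₀ + G`, where `G` has mean zero in `x₀`, so that `E F₀³G = 0`. The other terms of `E
f⁴` involve some `F a` with `a ≥ 1`, whose degree is lower and whose constant is therefore better by
the factor `c`; this gain pays for the numerical constants 8 and `3M`. -/
theorem gaussianExpMv_pow_four_le_of_expansion {n D : ℕ} {c : ℝ} (hc : 4 ≤ c)
    (hcM : 3 * gaussianExp ((∑ a ∈ Finset.Icc 1 D, hermiteNormalized a ^ 2) ^ 2) ≤ c ^ 2)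
    {K : ℝ} (hK : 0 ≤ K) (F : ℕ → MvPolynomial (Fin n) ℝ)
    (h0 : gaussianExpMv n (F 0 ^ 4) ≤ (K * gaussianExpMv n (F 0 ^ 2)) ^ 2)
    (hF : ∀ a ∈ Finset.Icc 1 D,
      gaussianExpMv n (F a ^ 4) ≤ (K / c * gaussianExpMv n (F a ^ 2)) ^ 2)
    {f : MvPolynomial (Fin (n + 1)) ℝ}
    (hf : f = ∑ a ∈ Finset.range (D + 1),
      Polynomial.aeval (MvPolynomial.X 0) (hermiteNormalized a) *
        MvPolynomial.rename Fin.succ (F a)) :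
    gaussianExpMv (n + 1) (f ^ 4) ≤ (K * gaussianExpMv (n + 1) (f ^ 2)) ^ 2 := by
  classical
  set A : ℕ → ℝ := fun a => gaussianExpMv n (F a ^ 2) with hA
  have hA0 : ∀ a, 0 ≤ A a := fun a => gaussianExpMv_nonneg fun x => by rw [map_pow]; positivity
  set W : ℕ → MvPolynomial (Fin (n + 1)) ℝ := fun a =>
    Polynomial.aeval (MvPolynomial.X 0) (hermiteNormalized a) with hW
  set R : ℕ → MvPolynomial (Fin (n + 1)) ℝ := fun a => MvPolynomial.rename Fin.succ (F a) with hR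
  set s := Finset.Icc 1 D with hs
  have hs0 : ∀ a ∈ s, a ≠ 0 := fun a ha => by
    have := (Finset.mem_Icc.mp ha).1
    omega
  set G := ∑ a ∈ s, W a * R a with hG
  have hfG : f = R 0 + G := by
    have h1 : Finset.range (D + 1) = insert 0 s := by
      ext a
      simp only [Finset.mem_range, Finset.mem_insert, hs, Finset.mem_Icc]
      omega
    rw [hf, h1, Finset.sum_insert (by simp [hs]), hermiteNormalized_zero]
    simp [hG, hW, hR]
  have hWW : ∀ a b : ℕ, ∀ q : MvPolynomial (Fin n) ℝ,
      gaussianExpMv (n + 1) (W a * W b * MvPolynomial.rename Fin.succ q) =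
        if a = b then gaussianExpMv n q else 0 := by
    intro a b q
    rw [hW]
    simp only
    rw [← map_mul, gaussianExpMv_mul_rename, gaussianExp_hermiteNormalized_mul]
    split_ifs <;> simp
  have hW1 : ∀ a ∈ s, ∀ q : MvPolynomial (Fin n) ℝ,
      gaussianExpMv (n + 1) (W a * MvPolynomial.rename Fin.succ q) = 0 := by
    intro a ha q
    rw [hW]
    simp only
    rw [gaussianExpMv_mul_rename, gaussianExp_hermiteNormalized (hs0 a ha), zero_mul]
  have hW0 : ∀ q : MvPolynomial (Fin n) ℝ,
      gaussianExpMv (n + 1) (MvPolynomial.rename Fin.succ q) = gaussianExpMv n q := by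
    intro q
    have := hWW 0 0 q
    simpa [hW, hermiteNormalized_zero] using this
  have hlin : ∀ q : MvPolynomial (Fin n) ℝ,
      gaussianExpMv (n + 1) (MvPolynomial.rename Fin.succ q * G) = 0 := by
    intro q
    rw [hG, Finset.mul_sum, map_sum]
    refine Finset.sum_eq_zero fun a ha => ?_
    rw [← hW1 a ha (q * F a)]
    congr 1
    simp only [hR, map_mul]
    ring
  have hquad : ∀ q : MvPolynomial (Fin n) ℝ,
      gaussianExpMv (n + 1) (MvPolynomial.rename Fin.succ q * G ^ 2) =
        ∑ a ∈ s, gaussianExpMv n (q * F a ^ 2) := by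
    intro q
    rw [hG, sq, Finset.sum_mul_sum, Finset.mul_sum, map_sum]
    refine Finset.sum_congr rfl fun a ha => ?_
    rw [Finset.mul_sum, map_sum]
    have h1 : ∀ b ∈ s, gaussianExpMv (n + 1) (MvPolynomial.rename Fin.succ q *
        (W a * R a * (W b * R b))) = if a = b then gaussianExpMv n (q * F a * F b) else 0 := by
      intro b _
      rw [← hWW]
      congr 1
      simp only [map_mul, hR]
      ring
    rw [Finset.sum_congr rfl h1, Finset.sum_ite_eq, if_pos ha]
    congr 1
    ring
  have hf2 : gaussianExpMv (n + 1) (f ^ 2) = A 0 + ∑ a ∈ s, A a := by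
    have h1 : f ^ 2 = MvPolynomial.rename Fin.succ (F 0 ^ 2) +
        (2 : ℝ) • (MvPolynomial.rename Fin.succ (F 0) * G) +
        MvPolynomial.rename Fin.succ 1 * G ^ 2 := by
      rw [hfG]
      simp only [MvPolynomial.smul_eq_C_mul, map_ofNat, map_pow, map_one, hR]
      ring
    rw [h1, map_add, map_add, map_smul, hlin, hquad, hW0]
    simp [hA]
  have hfour : gaussianExpMv (n + 1) (f ^ 4) ≤ gaussianExpMv n (F 0 ^ 4) +
      8 * ∑ a ∈ s, gaussianExpMv n (F 0 ^ 2 * F a ^ 2) + 3 * gaussianExpMv (n + 1) (G ^ 4) := by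
    -- The odd term `4uv³` in `(u + v)⁴` is absorbed by `4uv³ ≤ 2u²v² + 2v⁴`; the other odd term
    -- `4u³v` has expectation zero.
    have h1 : gaussianExpMv (n + 1) (f ^ 4) ≤ gaussianExpMv (n + 1)
        (MvPolynomial.rename Fin.succ (F 0 ^ 4) +
        (4 : ℝ) • (MvPolynomial.rename Fin.succ (F 0 ^ 3) * G) +
        (8 : ℝ) • (MvPolynomial.rename Fin.succ (F 0 ^ 2) * G ^ 2) + (3 : ℝ) • G ^ 4) := by
      refine gaussianExpMv_mono fun x => ?_
      rw [hfG]
      simp only [hR, map_add, map_mul, map_pow, MvPolynomial.smul_eval]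
      set u := MvPolynomial.eval x (MvPolynomial.rename Fin.succ (F 0))
      set v := MvPolynomial.eval x G
      nlinarith [sq_nonneg (u * v - v ^ 2)]
    refine h1.trans (le_of_eq ?_)
    simp only [map_add, map_smul, hlin, hquad, hW0, smul_eq_mul]
    ring
  set S := ∑ a ∈ s, K / c * A a with hS
  have hcross : ∀ a ∈ s, gaussianExpMv n (F 0 ^ 2 * F a ^ 2) ≤ (K * A 0) * (K / c * A a) := by
    intro a ha
    have := hA0 a
    have := hA0 0
    refine gaussianExpMv_mul_le (by positivity) (by positivity) ?_ ?_
    · rw [← pow_mul]; exact h0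
    · rw [← pow_mul]; exact hF a ha
  have hcross' : ∀ a ∈ s, ∀ b ∈ s,
      gaussianExpMv n (F a ^ 2 * F b ^ 2) ≤ (K / c * A a) * (K / c * A b) := by
    intro a ha b hb
    have := hA0 a
    have := hA0 b
    refine gaussianExpMv_mul_le (by positivity) (by positivity) ?_ ?_
    · rw [← pow_mul]; exact hF a ha
    · rw [← pow_mul]; exact hF b hb
  have hsum1 : ∑ a ∈ s, gaussianExpMv n (F 0 ^ 2 * F a ^ 2) ≤ K * A 0 * S := by
    rw [hS, Finset.mul_sum]
    exact Finset.sum_le_sum hcross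
  set M := gaussianExp ((∑ a ∈ s, hermiteNormalized a ^ 2) ^ 2) with hM
  have hM0 : 0 ≤ M := integral_nonneg fun t => by simp only [Polynomial.eval_pow]; positivity
  have hG4 : gaussianExpMv (n + 1) (G ^ 4) ≤ M * S ^ 2 := by
    -- Pointwise Cauchy–Schwarz over `a` separates `x₀` from the remaining variables, so the
    -- expectation factors.
    have h1 : gaussianExpMv (n + 1) (G ^ 4) ≤ gaussianExpMv (n + 1)
        (Polynomial.aeval (MvPolynomial.X 0) ((∑ a ∈ s, hermiteNormalized a ^ 2) ^ 2) *
          MvPolynomial.rename Fin.succ ((∑ a ∈ s, F a ^ 2) ^ 2)) := by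
      refine gaussianExpMv_mono fun x => ?_
      simp only [map_pow, map_sum, map_mul, hG]
      have h2 := Finset.sum_mul_sq_le_sq_mul_sq s (fun a => MvPolynomial.eval x (W a))
        (fun a => MvPolynomial.eval x (R a))
      have h3 := pow_le_pow_left₀ (by positivity) h2 2
      rw [← pow_mul, mul_pow] at h3
      exact h3
    refine h1.trans ?_
    rw [gaussianExpMv_mul_rename, ← hM]
    refine mul_le_mul_of_nonneg_left ?_ hM0
    rw [sq, Finset.sum_mul_sum, map_sum, hS, sq, Finset.sum_mul_sum]
    refine Finset.sum_le_sum fun a ha => ?_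
    rw [map_sum]
    exact Finset.sum_le_sum fun b hb => hcross' a ha b hb
  set U := ∑ a ∈ s, A a with hU
  have hU0 : 0 ≤ U := Finset.sum_nonneg fun a _ => hA0 a
  have hSU : c * S = K * U := by
    rw [hS, ← Finset.mul_sum, ← hU]
    field_simp
  have hS0 : 0 ≤ S := Finset.sum_nonneg fun a _ => by have := hA0 a; positivity
  have hKA : 0 ≤ K * A 0 := mul_nonneg hK (hA0 0)
  rw [hf2]
  calc gaussianExpMv (n + 1) (f ^ 4) ≤ (K * A 0) ^ 2 + 8 * (K * A 0 * S) + 3 * (M * S ^ 2) := by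
        linarith
    -- From `8 ≤ 2c` and `3M ≤ c²`. Since `cS = KU`, the right side is a perfect square.
    _ ≤ (K * A 0) ^ 2 + 2 * (K * A 0 * (c * S)) + c ^ 2 * S ^ 2 := by
        nlinarith [mul_nonneg hKA hS0, sq_nonneg S]
    _ = (K * (A 0 + U)) ^ 2 := by
        rw [show c ^ 2 * S ^ 2 = (c * S) ^ 2 by ring, hSU]
        ring

/-- Induction on the number of variables with `d` left free, since splitting off one variable lowers
the degree of the higher coefficients. The constant depends only on one-variable moments up to `D`,
hence not on `n`. -/
theorem exists_gaussianExpMv_pow_four_le (D : ℕ) :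
    ∃ c : ℝ, 1 ≤ c ∧ ∀ n d : ℕ, d ≤ D → ∀ f : MvPolynomial (Fin n) ℝ, f.totalDegree ≤ d →
      gaussianExpMv n (f ^ 4) ≤ (c ^ d * gaussianExpMv n (f ^ 2)) ^ 2 := by
  set M := gaussianExp ((∑ a ∈ Finset.Icc 1 D, hermiteNormalized a ^ 2) ^ 2) with hM
  have hM0 : 0 ≤ M := integral_nonneg fun t => by simp only [Polynomial.eval_pow]; positivity
  set c := 3 * M + 4 with hc
  have hc4 : 4 ≤ c := by linarith
  refine ⟨c, by linarith, fun n => ?_⟩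
  induction n with
  | zero =>
    intro d _ f _
    rw [MvPolynomial.eq_C_of_isEmpty f, ← map_pow, ← map_pow, gaussianExpMv_C, gaussianExpMv_C]
    set r := MvPolynomial.coeff 0 f
    have h1 : 1 ≤ c ^ d := one_le_pow₀ (by linarith)
    calc r ^ 4 = (1 * r ^ 2) ^ 2 := by ring
      _ ≤ (c ^ d * r ^ 2) ^ 2 := by gcongr
  | succ n ih =>
    intro d hd f hf
    obtain ⟨F, hF, hfF⟩ := exists_hermite_expansion hd f hf
    refine gaussianExpMv_pow_four_le_of_expansion hc4 (by nlinarith) (by positivity) F ?_ ?_ hfF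
    · refine ih d hd (F 0) ?_
      rcases hF 0 with h | h
      · simp [h]
      · omega
    · intro a ha
      have ha1 := (Finset.mem_Icc.mp ha).1
      rcases hF a with h | h
      · simp [h]
      -- For `a ≥ 1` the degree is at most `d - 1`, and `c^(d-1)` is exactly the required `c^d / c`.
      · obtain ⟨e, rfl⟩ : ∃ e, d = e + 1 := ⟨d - 1, by omega⟩
        have := ih e (by omega) (F a) (by omega)
        rwa [pow_succ c e, mul_div_cancel_right₀ _ (by positivity : c ≠ 0)]

/-- Each doubling of the exponent is the fourth-moment bound applied to `f^(2^r)`, of degree at most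
`2^r D`. -/
theorem exists_gaussianExpMv_pow_two_pow_le (D r : ℕ) :
    ∃ C : ℝ, 0 ≤ C ∧ ∀ n : ℕ, ∀ f : MvPolynomial (Fin n) ℝ, f.totalDegree ≤ D →
      gaussianExpMv n (f ^ 2 ^ (r + 1)) ≤ C * gaussianExpMv n (f ^ 2) ^ 2 ^ r := by
  induction r with
  | zero => exact ⟨1, by norm_num, fun n f _ => by simp⟩
  | succ r ih =>
    obtain ⟨C, hC0, hC⟩ := ih
    obtain ⟨c, hc1, hc⟩ := exists_gaussianExpMv_pow_four_le (2 ^ r * D)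
    refine ⟨(c ^ (2 ^ r * D) * C) ^ 2, by positivity, fun n f hf => ?_⟩
    have h1 := hc n (2 ^ r * D) le_rfl (f ^ 2 ^ r)
      ((MvPolynomial.totalDegree_pow _ _).trans (Nat.mul_le_mul_left _ hf))
    rw [← pow_mul, ← pow_mul, show 2 ^ r * 4 = 2 ^ (r + 1 + 1) by ring, ← pow_succ] at h1
    have h2 : 0 ≤ gaussianExpMv n (f ^ 2 ^ (r + 1)) := gaussianExpMv_nonneg fun x => by
      rw [map_pow, pow_succ, pow_mul]; positivity
    have h3 : 0 ≤ gaussianExpMv n (f ^ 2) := gaussianExpMv_nonneg fun x => by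
      rw [map_pow]; positivity
    calc gaussianExpMv n (f ^ 2 ^ (r + 1 + 1))
        ≤ (c ^ (2 ^ r * D) * gaussianExpMv n (f ^ 2 ^ (r + 1))) ^ 2 := h1
      _ ≤ (c ^ (2 ^ r * D) * (C * gaussianExpMv n (f ^ 2) ^ 2 ^ r)) ^ 2 := by
          gcongr
          exact hC n f hf
      _ = _ := by rw [pow_succ 2 r, pow_mul]; ring

/-! ### The Hermite kernel and its diagonal. -/

theorem totalDegree_hermiteMv_le {n : ℕ} (I : Fin n →₀ ℕ) :
    (hermiteMv I).totalDegree ≤ I.degree := by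
  rw [hermiteMv, Finsupp.degree_eq_sum]
  refine (MvPolynomial.totalDegree_finsetProd _ _).trans (Finset.sum_le_sum fun k _ => ?_)
  rw [Polynomial.aeval_eq_sum_range, Polynomial.natDegree_eq_of_degree_eq_some
    (hermiteNormalized_degree (I k))]
  refine MvPolynomial.totalDegree_finsetSum_le fun a ha => ?_
  refine (MvPolynomial.totalDegree_smul_le _ _).trans ?_
  rw [MvPolynomial.totalDegree_X_pow]
  have := Finset.mem_range.mp ha
  omega

/-- The kernel `∑ h_I(x) h_I(y)`, the sum over the multisets `I` with `0 < |I| ≤ d`. -/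
noncomputable def hermiteKernel {n : ℕ} (d : ℕ) (x y : Fin n → ℝ) : ℝ :=
  ∑ I : HermiteIndex n d, MvPolynomial.eval x (hermiteMv I.1) * MvPolynomial.eval y (hermiteMv I.1)

theorem measurable_hermiteKernel (n d : ℕ) :
    Measurable fun q : (Fin n → ℝ) × (Fin n → ℝ) => hermiteKernel d q.1 q.2 := by
  unfold hermiteKernel
  refine Finset.measurable_sum _ fun I _ => ?_
  have h := (MvPolynomial.continuous_eval (hermiteMv I.1)).measurable
  exact (h.comp measurable_fst).mul (h.comp measurable_snd)

theorem card_hermiteIndex_le (n d : ℕ) : Fintype.card (HermiteIndex n d) ≤ (n + 1) ^ d := by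
  classical
  have key : ∀ d : ℕ, ∃ s : Finset (Fin n →₀ ℕ), s.card ≤ (n + 1) ^ d ∧
      ∀ I : Fin n →₀ ℕ, I.degree ≤ d → I ∈ s := by
    intro d
    induction d with
    | zero => exact ⟨{0}, by simp, fun I hI => by
        simpa using (Finsupp.degree_eq_zero_iff I).mp (Nat.le_zero.mp hI)⟩
    | succ d ih =>
      obtain ⟨s, hs, hI⟩ := ih
      -- A nonzero multiset of size at most `d + 1` is one of size at most `d` with one element of
      -- `[n]` added, hence the factor `n + 1`.
      refine ⟨s ∪ Finset.univ.biUnion fun k => s.image fun I => I + Finsupp.single k 1, ?_, ?_⟩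
      · calc _ ≤ s.card + ∑ k : Fin n, (s.image fun I => I + Finsupp.single k 1).card :=
              (Finset.card_union_le _ _).trans (Nat.add_le_add_left Finset.card_biUnion_le _)
          _ ≤ s.card + ∑ _k : Fin n, s.card := by
              exact Nat.add_le_add_left (Finset.sum_le_sum fun k _ => Finset.card_image_le) _
          _ = s.card * (n + 1) := by simp; ring
          _ ≤ (n + 1) ^ (d + 1) := by rw [pow_succ]; gcongr
      · intro I hId
        rw [Finset.mem_union]
        by_cases h0 : I = 0
        · subst h0
          exact Or.inl (hI 0 (by simp))
        · right
          obtain ⟨k, hk⟩ := Finsupp.ne_iff.mp h0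
          have h1 : I - Finsupp.single k 1 + Finsupp.single k 1 = I := by
            refine tsub_add_cancel_of_le ?_
            rw [Finsupp.single_le_iff]
            exact Nat.one_le_iff_ne_zero.mpr hk
          simp only [Finset.mem_biUnion, Finset.mem_univ, true_and, Finset.mem_image]
          refine ⟨k, I - Finsupp.single k 1, hI _ ?_, h1⟩
          have h2 := congrArg Finsupp.degree h1
          rw [map_add, Finsupp.degree_single] at h2
          omega
  obtain ⟨s, hs, hI⟩ := key d
  refine le_trans ?_ hs
  rw [← Fintype.card_coe]
  exact Fintype.card_le_of_injective (fun I : HermiteIndex n d => (⟨I.1, hI I.1 I.2.2⟩ : s))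
    fun I J h => Subtype.ext (by simpa using h)

theorem exists_abs_eval_hermiteNormalized_le (d : ℕ) :
    ∃ B : ℝ, 1 ≤ B ∧ ∀ j ≤ d, ∀ L t : ℝ, 1 ≤ L → |t| ≤ L →
      |(hermiteNormalized j).eval t| ≤ B * L ^ d := by
  refine ⟨1 + ∑ j ∈ Finset.range (d + 1), ∑ a ∈ Finset.range (d + 1),
    |(hermiteNormalized j).coeff a|, ?_, fun j hj L t hL ht => ?_⟩
  · exact le_add_of_nonneg_right (Finset.sum_nonneg fun j _ => Finset.sum_nonneg fun a _ =>
      abs_nonneg _)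
  have hnat : (hermiteNormalized j).natDegree < d + 1 := by
    rw [Polynomial.natDegree_eq_of_degree_eq_some (hermiteNormalized_degree j)]
    omega
  have hLd : 0 ≤ L ^ d := by positivity
  have h1 : ∑ a ∈ Finset.range (d + 1), |(hermiteNormalized j).coeff a| ≤
      ∑ j ∈ Finset.range (d + 1), ∑ a ∈ Finset.range (d + 1), |(hermiteNormalized j).coeff a| :=
    Finset.single_le_sum (f := fun j => ∑ a ∈ Finset.range (d + 1),
      |(hermiteNormalized j).coeff a|)
      (fun j _ => Finset.sum_nonneg fun a _ => abs_nonneg _) (Finset.mem_range.mpr (by omega))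
  calc |(hermiteNormalized j).eval t|
      = |∑ a ∈ Finset.range (d + 1), (hermiteNormalized j).coeff a * t ^ a| := by
        rw [Polynomial.eval_eq_sum_range' hnat]
    _ ≤ ∑ a ∈ Finset.range (d + 1), |(hermiteNormalized j).coeff a * t ^ a| :=
        Finset.abs_sum_le_sum_abs _ _
    _ ≤ ∑ a ∈ Finset.range (d + 1), |(hermiteNormalized j).coeff a| * L ^ d := by
        refine Finset.sum_le_sum fun a ha => ?_
        rw [abs_mul, abs_pow]
        gcongr
        have := Finset.mem_range.mp ha
        exact (pow_le_pow_left₀ (abs_nonneg t) ht a).trans (pow_le_pow_right₀ hL (by omega))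
    _ = (∑ a ∈ Finset.range (d + 1), |(hermiteNormalized j).coeff a|) * L ^ d :=
        (Finset.sum_mul _ _ _).symm
    _ ≤ _ := mul_le_mul_of_nonneg_right (by linarith) hLd

/-- Since `h_0 = 1`, at most `d` of the `n` factors of `h_I` are nontrivial. Each `h_I` is thus
bounded independently of `n`, and only the number of indices depends on `n`. -/
theorem exists_hermiteKernel_self_le (d : ℕ) :
    ∃ B : ℝ, 1 ≤ B ∧ ∀ n : ℕ, ∀ L : ℝ, 1 ≤ L → ∀ x : Fin n → ℝ, (∀ k, |x k| ≤ L) →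
      hermiteKernel d x x ≤ (n + 1 : ℝ) ^ d * (B * L ^ d) ^ (2 * d) := by
  obtain ⟨B, hB1, hB⟩ := exists_abs_eval_hermiteNormalized_le d
  refine ⟨B, hB1, fun n L hL x hx => ?_⟩
  have hBL : 1 ≤ B * L ^ d := one_le_mul_of_one_le_of_one_le hB1 (one_le_pow₀ hL)
  have hI : ∀ I : HermiteIndex n d, MvPolynomial.eval x (hermiteMv I.1) *
      MvPolynomial.eval x (hermiteMv I.1) ≤ (B * L ^ d) ^ (2 * d) := by
    intro I
    have h1 : |MvPolynomial.eval x (hermiteMv I.1)| ≤ (B * L ^ d) ^ d := by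
      rw [hermiteMv, map_prod, Finset.abs_prod]
      calc ∏ k, |MvPolynomial.eval x (Polynomial.aeval (MvPolynomial.X k)
            (hermiteNormalized (I.1 k)))| ≤ ∏ k, (B * L ^ d) ^ (I.1 k) := by
            refine Finset.prod_le_prod (fun k _ => abs_nonneg _) fun k _ => ?_
            rw [eval_aeval_X]
            by_cases hk : I.1 k = 0
            · simp [hk, hermiteNormalized_zero]
            · have hkd : I.1 k ≤ d := (Finsupp.le_degree k I.1).trans I.2.2
              exact (hB _ hkd L _ hL (hx k)).trans (le_self_pow₀ hBL hk)
        _ = (B * L ^ d) ^ I.1.degree := by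
            rw [Finset.prod_pow_eq_pow_sum, Finsupp.degree_eq_sum]
        _ ≤ (B * L ^ d) ^ d := pow_le_pow_right₀ hBL I.2.2
    calc _ = |MvPolynomial.eval x (hermiteMv I.1)| ^ 2 := by rw [sq_abs, sq]
      _ ≤ ((B * L ^ d) ^ d) ^ 2 := by gcongr
      _ = _ := by rw [← pow_mul, mul_comm d 2]
  calc hermiteKernel d x x ≤ ∑ _I : HermiteIndex n d, (B * L ^ d) ^ (2 * d) :=
        Finset.sum_le_sum fun I _ => hI I
    _ = (Fintype.card (HermiteIndex n d) : ℝ) * (B * L ^ d) ^ (2 * d) := by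
        simp [Finset.sum_const, Finset.card_univ]
    _ ≤ _ := by
        gcongr
        exact_mod_cast card_hermiteIndex_le n d

/-! ### Tail bounds for coordinates and for the kernel at two independent points. -/

/-- Chernoff bound. The parameter `A` is kept free because at `L = log n` a fixed `A` yields the
power `n^(-A)`. -/
theorem gaussianReal_abs_ge_le {A : ℝ} (hA : 0 ≤ A) (L : ℝ) :
    (gaussianReal 0 1).real {t | L ≤ |t|} ≤ 2 * Real.exp (A ^ 2 / 2 - A * L) := by
  have h1 : (gaussianReal 0 1).real {t | L ≤ t} ≤ Real.exp (A ^ 2 / 2 - A * L) := by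
    have := measure_ge_le_exp_mul_mgf (X := id) (μ := gaussianReal 0 1) L hA
      (integrable_exp_mul_gaussianReal A)
    rw [mgf_id_gaussianReal, ← Real.exp_add] at this
    refine this.trans (le_of_eq ?_)
    congr 1
    simp
    ring
  have h2 : (gaussianReal 0 1).real {t | L ≤ -t} ≤ Real.exp (A ^ 2 / 2 - A * L) := by
    have h4 : MeasurePreserving (fun x : ℝ => -x) (gaussianReal 0 1) (gaussianReal 0 1) :=
      ⟨measurable_neg, by rw [gaussianReal_map_neg, neg_zero]⟩
    have h3 : (gaussianReal 0 1).real {t | L ≤ -t} = (gaussianReal 0 1).real {t | L ≤ t} :=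
      h4.measureReal_preimage measurableSet_Ici.nullMeasurableSet
    rw [h3]
    exact h1
  have h5 : {t : ℝ | L ≤ |t|} = {t | L ≤ t} ∪ {t | L ≤ -t} := by
    ext t
    simp [le_abs]
  rw [h5]
  refine (measureReal_union_le _ _).trans ?_
  linarith

/-- Hypercontractivity is used twice: for `K(·, y)` with `y` fixed, whose second moment is `K(y,
y)`, and for each `h_I` when `K(y, y)^(2^r)` is averaged over `y`. Markov's inequality for the
moment of order `2^(r+1)` concludes. -/
theorem exists_measure_hermiteKernel_ge_le (d r : ℕ) :
    ∃ C : ℝ, 0 ≤ C ∧ ∀ n : ℕ, ∀ T : ℝ, 0 < T →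
      ((Measure.pi fun _ : Fin n => gaussianReal 0 1).prod
        (Measure.pi fun _ : Fin n => gaussianReal 0 1)).real
          {q | T ≤ |hermiteKernel d q.1 q.2|} ≤
        C * (n + 1 : ℝ) ^ (d * 2 ^ r) / T ^ 2 ^ (r + 1) := by
  obtain ⟨C, hC0, hC⟩ := exists_gaussianExpMv_pow_two_pow_le d r
  refine ⟨C * C, by positivity, fun n T hT => ?_⟩
  set γ := Measure.pi fun _ : Fin n => gaussianReal 0 1 with hγ
  set N := Fintype.card (HermiteIndex n d) with hN
  have heven : ∀ a : ℝ, 0 ≤ a ^ 2 ^ (r + 1) := fun a => by rw [pow_succ, mul_comm, pow_mul]; positivity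
  have hker : ∀ y : Fin n → ℝ, Integrable (fun x => hermiteKernel d x y ^ 2 ^ (r + 1)) γ ∧
      ∫ x, hermiteKernel d x y ^ 2 ^ (r + 1) ∂γ ≤ C * hermiteKernel d y y ^ 2 ^ r := by
    intro y
    set f : MvPolynomial (Fin n) ℝ :=
      ∑ I : HermiteIndex n d, MvPolynomial.eval y (hermiteMv I.1) • hermiteMv I.1 with hf
    have hfx : ∀ x, hermiteKernel d x y = MvPolynomial.eval x f := by
      intro x
      simp [hf, hermiteKernel, map_sum, MvPolynomial.smul_eval, mul_comm]
    have hdeg : f.totalDegree ≤ d := by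
      refine MvPolynomial.totalDegree_finsetSum_le fun I _ => ?_
      exact (MvPolynomial.totalDegree_smul_le _ _).trans
        ((totalDegree_hermiteMv_le I.1).trans I.2.2)
    have h2 : gaussianExpMv n (f ^ 2) = hermiteKernel d y y := by
      rw [hf, gaussianExpMv_sq_sum_hermiteMv Subtype.val_injective]
      simp [hermiteKernel, sq]
    have h3 : (fun x => hermiteKernel d x y ^ 2 ^ (r + 1)) =
        fun x => MvPolynomial.eval x (f ^ 2 ^ (r + 1)) := by
      ext x
      rw [hfx, map_pow]
    rw [h3, ← h2]
    exact ⟨integrable_eval_gaussian _, hC n f hdeg⟩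
  have hself : Integrable (fun y => hermiteKernel d y y ^ 2 ^ r) γ ∧
      ∫ y, hermiteKernel d y y ^ 2 ^ r ∂γ ≤ C * (N : ℝ) ^ 2 ^ r := by
    set f : MvPolynomial (Fin n) ℝ := ∑ I : HermiteIndex n d, hermiteMv I.1 ^ 2 with hf
    have hfx : (fun y => hermiteKernel d y y ^ 2 ^ r) =
        fun y => MvPolynomial.eval y (f ^ 2 ^ r) := by
      ext y
      simp [hf, hermiteKernel, map_sum, sq]
    -- The power mean inequality below is stated for an exponent `s + 1`; it moves the power `2^r`
    -- inside the sum over `I` at the cost of `N^s`.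
    obtain ⟨s, hs⟩ : ∃ s, 2 ^ r = s + 1 := ⟨2 ^ r - 1, by have := Nat.one_le_two_pow (n := r); omega⟩
    have h1 : gaussianExpMv n (f ^ 2 ^ r) ≤ gaussianExpMv n
        ((N : ℝ) ^ s • ∑ I : HermiteIndex n d, hermiteMv I.1 ^ 2 ^ (r + 1)) := by
      refine gaussianExpMv_mono fun x => ?_
      have h2 := pow_sum_le_card_mul_sum_pow (s := Finset.univ)
        (f := fun I : HermiteIndex n d => MvPolynomial.eval x (hermiteMv I.1) ^ 2)
        (fun I _ => sq_nonneg _) s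
      rw [← hs, Finset.card_univ] at h2
      simpa only [hf, map_pow, map_sum, MvPolynomial.smul_eval, ← pow_mul, ← pow_succ'] using h2
    have h2 : ∀ I : HermiteIndex n d, gaussianExpMv n (hermiteMv I.1 ^ 2 ^ (r + 1)) ≤ C := by
      intro I
      have h3 := hC n (hermiteMv I.1) ((totalDegree_hermiteMv_le I.1).trans I.2.2)
      rw [sq (hermiteMv I.1), gaussianExpMv_hermiteMv_mul] at h3
      simpa using h3
    refine ⟨hfx ▸ integrable_eval_gaussian _, ?_⟩
    rw [hfx, ← gaussianExpMv_apply]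
    refine h1.trans ?_
    rw [map_smul, map_sum, smul_eq_mul]
    calc (N : ℝ) ^ s * ∑ I : HermiteIndex n d, gaussianExpMv n (hermiteMv I.1 ^ 2 ^ (r + 1))
        ≤ (N : ℝ) ^ s * ∑ _I : HermiteIndex n d, C := by
          gcongr with I
          exact h2 I
      _ = C * (N : ℝ) ^ 2 ^ r := by
          rw [hs, Finset.sum_const, Finset.card_univ, ← hN, nsmul_eq_mul]
          ring
  have hmeas := measurable_hermiteKernel n d
  have hset : {q : (Fin n → ℝ) × (Fin n → ℝ) | T ≤ |hermiteKernel d q.1 q.2|} ⊆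
      {q | ENNReal.ofReal (T ^ 2 ^ (r + 1)) ≤
        ENNReal.ofReal (hermiteKernel d q.1 q.2 ^ 2 ^ (r + 1))} := by
    intro q hq
    refine ENNReal.ofReal_le_ofReal ?_
    rw [pow_succ 2 r, mul_comm, pow_mul, pow_mul, ← sq_abs (hermiteKernel d q.1 q.2)]
    gcongr
    exact hq
  have hlint : ∫⁻ q, ENNReal.ofReal (hermiteKernel d q.1 q.2 ^ 2 ^ (r + 1)) ∂(γ.prod γ) ≤
      ENNReal.ofReal (C * (C * (N : ℝ) ^ 2 ^ r)) := by
    rw [lintegral_prod_symm _ (by fun_prop)]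
    calc ∫⁻ y, ∫⁻ x, ENNReal.ofReal (hermiteKernel d x y ^ 2 ^ (r + 1)) ∂γ ∂γ
        ≤ ∫⁻ y, ENNReal.ofReal (C * hermiteKernel d y y ^ 2 ^ r) ∂γ := by
          refine lintegral_mono fun y => ?_
          rw [← ofReal_integral_eq_lintegral_ofReal (hker y).1 (.of_forall fun x => heven _)]
          exact ENNReal.ofReal_le_ofReal (hker y).2
      _ = ENNReal.ofReal (∫ y, C * hermiteKernel d y y ^ 2 ^ r ∂γ) := by
          rw [ofReal_integral_eq_lintegral_ofReal (hself.1.const_mul C)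
            (.of_forall fun y => ?_)]
          have : 0 ≤ hermiteKernel d y y := Finset.sum_nonneg fun I _ => mul_self_nonneg _
          positivity
      _ ≤ _ := by
          refine ENNReal.ofReal_le_ofReal ?_
          rw [integral_const_mul]
          exact mul_le_mul_of_nonneg_left hself.2 hC0
  have hmarkov := mul_meas_ge_le_lintegral₀ (μ := γ.prod γ)
    (f := fun q => ENNReal.ofReal (hermiteKernel d q.1 q.2 ^ 2 ^ (r + 1))) (by fun_prop)
    (ENNReal.ofReal (T ^ 2 ^ (r + 1)))
  have hTq : 0 < T ^ 2 ^ (r + 1) := by positivity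
  rw [le_div_iff₀ hTq, mul_comm _ (T ^ 2 ^ (r + 1))]
  have h1 : ENNReal.ofReal (T ^ 2 ^ (r + 1)) *
      (γ.prod γ) {q | T ≤ |hermiteKernel d q.1 q.2|} ≤
        ENNReal.ofReal (C * (C * (N : ℝ) ^ 2 ^ r)) :=
    ((mul_le_mul_right (measure_mono hset) _).trans hmarkov).trans hlint
  have h2 := ENNReal.toReal_mono ENNReal.ofReal_ne_top h1
  rw [ENNReal.toReal_mul, ENNReal.toReal_ofReal hTq.le, ENNReal.toReal_ofReal (by positivity)] at h2
  refine h2.trans ?_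
  rw [← mul_assoc, pow_mul]
  gcongr
  exact_mod_cast card_hermiteIndex_le n d

theorem map_eval_pair_pi {ι α : Type*} [Fintype ι] [MeasurableSpace α] (μ : Measure α)
    [IsProbabilityMeasure μ] {i j : ι} (hij : i ≠ j) :
    (Measure.pi fun _ : ι => μ).map (fun p => (p i, p j)) = μ.prod μ := by
  have h1 : iIndepFun (fun i (ω : ι → α) => ω i) (Measure.pi fun _ : ι => μ) :=
    iIndepFun_pi (X := fun _ => id) fun _ => aemeasurable_id
  have h2 := (indepFun_iff_map_prod_eq_prod_map_map 
    (measurable_pi_apply i).aemeasurable (measurable_pi_apply j).aemeasurable).mp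
    (h1.indepFun hij)
  rw [h2, (measurePreserving_eval _ i).map_eq, (measurePreserving_eval _ j).map_eq]

/-! ### Reduction to the Gram matrix of the samples. -/

/-- Bessel's inequality: enlarging `s` by the support of the expansion gives equality. Thus no
degree bound on `g` is needed. -/
theorem sum_repr_sq_le {n : ℕ} (s : Finset (Fin n →₀ ℕ)) (g : MvPolynomial (Fin n) ℝ) :
    ∑ J ∈ s, (hermiteBasis n).repr g J ^ 2 ≤ gaussianExpMv n (g ^ 2) := by
  classical
  set t := s ∪ ((hermiteBasis n).repr g).support with ht
  have h1 : g = ∑ J ∈ t, (hermiteBasis n).repr g J • hermiteMv J := by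
    conv_lhs => rw [← (hermiteBasis n).linearCombination_repr g, Finsupp.linearCombination_apply]
    rw [Finsupp.sum_of_support_subset _
      (Finset.subset_union_right (s₁ := s)) _ (by simp)]
    refine Finset.sum_congr rfl fun J _ => ?_
    rw [hermiteBasis, Module.Basis.mk_apply]
  calc _ ≤ ∑ J ∈ t, (hermiteBasis n).repr g J ^ 2 :=
        Finset.sum_le_sum_of_subset_of_nonneg Finset.subset_union_left fun _ _ _ => sq_nonneg _
    _ = gaussianExpMv n (g ^ 2) := by
        conv_rhs => rw [h1]
        exact (gaussianExpMv_sq_sum_hermiteMv Function.injective_id t _).symm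

/-- The vector on the left consists of Hermite coefficients of `f²`, where `f` has coefficient
vector `Hx`. Bessel gives `E f⁴`, hypercontractivity gives `(E f²)²`, and Parseval turns `E f²` into
`‖Hx‖²`. This step is deterministic in the points. -/
theorem exists_norm_sq_linearization_le (d : ℕ) :
    ∃ c : ℝ, 0 ≤ c ∧ ∀ (n m : ℕ) (p : Fin m → Fin n → ℝ) (x : EuclideanSpace ℝ (Fin m)),
      ‖WithLp.toLp 2 ((linearizationMatrix n d *
        (hermiteMatrix d p ⊗ₖ hermiteMatrix d p)).mulVec (tensorSquare x))‖ ^ 2 ≤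
      c * (∑ I : HermiteIndex n d,
        (∑ i, MvPolynomial.eval (p i) (hermiteMv I.1) * x i) ^ 2) ^ 2 := by
  obtain ⟨c, hc1, hc⟩ := exists_gaussianExpMv_pow_four_le d
  refine ⟨(c ^ d) ^ 2, by positivity, fun n m p x => ?_⟩
  set v : HermiteIndex n d → ℝ := fun I => ∑ i, MvPolynomial.eval (p i) (hermiteMv I.1) * x i
    with hv
  set f : MvPolynomial (Fin n) ℝ := ∑ I : HermiteIndex n d, v I • hermiteMv I.1 with hf
  have hdeg : f.totalDegree ≤ d := MvPolynomial.totalDegree_finsetSum_le fun I _ =>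
    (MvPolynomial.totalDegree_smul_le _ _).trans ((totalDegree_hermiteMv_le I.1).trans I.2.2)
  have hcoord : ∀ J : ProductIndex n d, (linearizationMatrix n d *
      (hermiteMatrix d p ⊗ₖ hermiteMatrix d p)).mulVec (tensorSquare x) J =
        (hermiteBasis n).repr (f ^ 2) J.1 := by
    intro J
    rw [← Matrix.mulVec_mulVec]
    have h1 : (hermiteMatrix d p ⊗ₖ hermiteMatrix d p).mulVec (tensorSquare x) =
        fun II => v II.1 * v II.2 := by
      ext II
      simp only [Matrix.mulVec, dotProduct, Fintype.sum_prod_type, Matrix.kroneckerMap_apply,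
        hermiteMatrix, Matrix.of_apply, tensorSquare, hv, Finset.sum_mul_sum]
      refine Finset.sum_congr rfl fun i _ => Finset.sum_congr rfl fun j _ => ?_
      ring
    rw [h1, hf, sq, Finset.sum_mul_sum]
    simp only [Matrix.mulVec, dotProduct, Fintype.sum_prod_type, linearizationMatrix,
      Matrix.of_apply, map_sum, smul_mul_smul_comm, map_smul, Finsupp.coe_finsetSum,
      Finset.sum_apply, Finsupp.smul_apply, smul_eq_mul]
    refine Finset.sum_congr rfl fun i _ => Finset.sum_congr rfl fun j _ => mul_comm _ _
  rw [EuclideanSpace.real_norm_sq_eq]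
  calc ∑ J : ProductIndex n d, _ = ∑ J : ProductIndex n d,
        (hermiteBasis n).repr (f ^ 2) J.1 ^ 2 :=
        Finset.sum_congr rfl fun J _ => by rw [← hcoord]
    _ = ∑ J ∈ Finset.univ.map (Function.Embedding.subtype
          fun J : Fin n →₀ ℕ => J.degree ≤ 2 * d), (hermiteBasis n).repr (f ^ 2) J ^ 2 := by
        rw [Finset.sum_map]
        rfl
    _ ≤ gaussianExpMv n ((f ^ 2) ^ 2) := sum_repr_sq_le _ _
    _ ≤ (c ^ d * gaussianExpMv n (f ^ 2)) ^ 2 := by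
        rw [← pow_mul]
        exact hc n d le_rfl f hdeg
    _ = _ := by rw [hf, gaussianExpMv_sq_sum_hermiteMv Subtype.val_injective, mul_pow]

theorem sum_sq_le_of_hermiteKernel_le {n m : ℕ} (d : ℕ) (p : Fin m → Fin n → ℝ)
    (x : EuclideanSpace ℝ (Fin m)) {D T : ℝ} (hT : 0 ≤ T)
    (hdiag : ∀ i, hermiteKernel d (p i) (p i) ≤ D)
    (hoff : ∀ i j, i ≠ j → |hermiteKernel d (p i) (p j)| ≤ T) :
    ∑ I : HermiteIndex n d, (∑ i, MvPolynomial.eval (p i) (hermiteMv I.1) * x i) ^ 2 ≤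
      (D + m * T) * ‖x‖ ^ 2 := by
  have h1 : ∑ I : HermiteIndex n d, (∑ i, MvPolynomial.eval (p i) (hermiteMv I.1) * x i) ^ 2 =
      ∑ i, ∑ j, x i * x j * hermiteKernel d (p i) (p j) := by
    simp only [sq, Finset.sum_mul_sum, hermiteKernel]
    rw [Finset.sum_comm]
    refine Finset.sum_congr rfl fun i _ => ?_
    rw [Finset.sum_comm]
    refine Finset.sum_congr rfl fun j _ => ?_
    rw [Finset.mul_sum]
    refine Finset.sum_congr rfl fun I _ => ?_
    ring
  -- The `T` term is kept on the diagonal too, so that it sums to the full square `T (∑ |x i|)²`,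
  -- which Cauchy–Schwarz bounds by `T m ‖x‖²`.
  have h2 : ∀ i j, x i * x j * hermiteKernel d (p i) (p j) ≤
      T * (|x i| * |x j|) + if i = j then D * x i ^ 2 else 0 := by
    intro i j
    split_ifs with h
    · subst h
      have h3 := mul_le_mul_of_nonneg_left (hdiag i) (mul_self_nonneg (x i))
      have h4 : 0 ≤ T * (|x i| * |x i|) := by positivity
      linarith
    · rw [add_zero]
      refine (le_abs_self _).trans ?_
      rw [abs_mul, abs_mul, mul_comm]
      exact mul_le_mul_of_nonneg_right (hoff i j h) (by positivity)
  have h5 : (∑ i, |x i|) ^ 2 ≤ m * ‖x‖ ^ 2 := by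
    have := sq_sum_le_card_mul_sum_sq (s := Finset.univ) (f := fun i => |x i|)
    simpa [EuclideanSpace.real_norm_sq_eq] using this
  rw [h1]
  calc _ ≤ ∑ i, ∑ j, (T * (|x i| * |x j|) + if i = j then D * x i ^ 2 else 0) :=
        Finset.sum_le_sum fun i _ => Finset.sum_le_sum fun j _ => h2 i j
    _ = T * (∑ i, |x i|) ^ 2 + D * ‖x‖ ^ 2 := by
        rw [sq (∑ i, |x i|), Finset.sum_mul_sum, EuclideanSpace.real_norm_sq_eq]
        simp [Finset.sum_add_distrib, Finset.mul_sum]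
    _ ≤ _ := by nlinarith [mul_le_mul_of_nonneg_left h5 hT]

/-! ### The bad event and the choice of parameters. -/

theorem gaussianSamples_abs_ge_le {n m : ℕ} (i : Fin m) (k : Fin n) {A : ℝ} (hA : 0 ≤ A) (L : ℝ) :
    (gaussianSamples n m).real {p | L ≤ |p i k|} ≤ 2 * Real.exp (A ^ 2 / 2 - A * L) := by
  have h1 : MeasurePreserving (fun p : Fin m → Fin n → ℝ => p i k) (gaussianSamples n m)
      (gaussianReal 0 1) :=
    (measurePreserving_eval (fun _ : Fin n => gaussianReal 0 1) k).comp
      (measurePreserving_eval (fun _ : Fin m => Measure.pi fun _ : Fin n => gaussianReal 0 1) i)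
  refine le_trans (le_of_eq ?_) (gaussianReal_abs_ge_le hA L)
  exact h1.measureReal_preimage
    (measurableSet_le measurable_const measurable_norm).nullMeasurableSet

theorem exists_gaussianSamples_hermiteKernel_ge_le (d r : ℕ) :
    ∃ C : ℝ, 0 ≤ C ∧ ∀ (n m : ℕ) (i j : Fin m), i ≠ j → ∀ T : ℝ, 0 < T →
      (gaussianSamples n m).real {p | T ≤ |hermiteKernel d (p i) (p j)|} ≤
        C * (n + 1 : ℝ) ^ (d * 2 ^ r) / T ^ 2 ^ (r + 1) := by
  obtain ⟨C, hC0, hC⟩ := exists_measure_hermiteKernel_ge_le d r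
  refine ⟨C, hC0, fun n m i j hij T hT => ?_⟩
  refine le_trans (le_of_eq ?_) (hC n T hT)
  have h1 : MeasurePreserving (fun p : Fin m → Fin n → ℝ => (p i, p j)) (gaussianSamples n m)
      ((Measure.pi fun _ : Fin n => gaussianReal 0 1).prod
        (Measure.pi fun _ : Fin n => gaussianReal 0 1)) :=
    ⟨by fun_prop, map_eval_pair_pi _ hij⟩
  exact h1.measureReal_preimage (measurableSet_le measurable_const
    (measurable_norm.comp (measurable_hermiteKernel n d))).nullMeasurableSet

theorem exists_gaussianSamples_hermiteKernel_bad_le (d r : ℕ) :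
    ∃ C : ℝ, 0 ≤ C ∧ ∀ (n m : ℕ) (A L T : ℝ), 0 ≤ A → 0 < T →
      (gaussianSamples n m).real {p | (∃ i k, L ≤ |p i k|) ∨
        ∃ i j, i ≠ j ∧ T ≤ |hermiteKernel d (p i) (p j)|} ≤
      m * (n * (2 * Real.exp (A ^ 2 / 2 - A * L))) +
        m * (m * (C * (n + 1 : ℝ) ^ (d * 2 ^ r) / T ^ 2 ^ (r + 1))) := by
  obtain ⟨C, hC0, hC⟩ := exists_gaussianSamples_hermiteKernel_ge_le d r
  refine ⟨C, hC0, fun n m A L T hA hT => ?_⟩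
  have hset : {p : Fin m → Fin n → ℝ | (∃ i k, L ≤ |p i k|) ∨
        ∃ i j, i ≠ j ∧ T ≤ |hermiteKernel d (p i) (p j)|} ⊆
      (⋃ i, ⋃ k, {p | L ≤ |p i k|}) ∪
        ⋃ i, ⋃ j, {p | i ≠ j ∧ T ≤ |hermiteKernel d (p i) (p j)|} := by
    intro p hp
    simpa using hp
  have : IsProbabilityMeasure (gaussianSamples n m) := by
    unfold gaussianSamples
    infer_instance
  refine (measureReal_mono hset).trans ((measureReal_union_le _ _).trans (add_le_add ?_ ?_))
  · refine (measureReal_iUnion_fintype_le _).trans ?_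
    calc _ ≤ ∑ _i : Fin m, ∑ _k : Fin n, 2 * Real.exp (A ^ 2 / 2 - A * L) :=
          Finset.sum_le_sum fun i _ => (measureReal_iUnion_fintype_le _).trans
            (Finset.sum_le_sum fun k _ => gaussianSamples_abs_ge_le i k hA L)
      _ = _ := by simp
  · refine (measureReal_iUnion_fintype_le _).trans ?_
    calc _ ≤ ∑ _i : Fin m, ∑ _j : Fin m, C * (n + 1 : ℝ) ^ (d * 2 ^ r) / T ^ 2 ^ (r + 1) := by
          refine Finset.sum_le_sum fun i _ => (measureReal_iUnion_fintype_le _).trans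
            (Finset.sum_le_sum fun j _ => ?_)
          by_cases hij : i = j
          · simp only [hij, ne_eq, not_true_eq_false, false_and, Set.ofPred_false,
              measureReal_empty]
            positivity
          · simp only [ne_eq, hij, not_false_eq_true, true_and]
            exact hC n m i j hij T hT
      _ = _ := by simp

theorem mainTheorem7 (d : ℕ) :
    ∃ (C : ℝ) (k : ℕ), ∀ δ : ℝ, 0 < δ → ∀ β : ℝ, 0 < β →
      ∃ N : ℕ, ∀ n : ℕ, N ≤ n → ∀ m : ℕ, (m : ℝ) ≤ (n : ℝ) ^ ((d : ℝ) / 2 - δ) →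
        1 - (n : ℝ) ^ (-β) ≤
          (gaussianSamples n m).real
            {p | ∀ x : EuclideanSpace ℝ (Fin m),
              ‖WithLp.toLp 2 ((linearizationMatrix n d *
                  (hermiteMatrix d p ⊗ₖ hermiteMatrix d p)).mulVec (tensorSquare x))‖ ^ 2 ≤
                C * (Real.log n) ^ k * (n : ℝ) ^ (2 * d) * ‖x‖ ^ 4} := by
  obtain ⟨c, hc0, hc⟩ := exists_norm_sq_linearization_le d
  obtain ⟨B, hB1, hB⟩ := exists_hermiteKernel_self_le d
  -- The first summand comes from the diagonal, with `n + 1 ≤ 2n`; the 1 comes from `m T ≤ n^d`.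
  -- Squaring the bound on `‖Hx‖²` gives `b²` and doubles the logarithmic exponent `2d²`.
  set b : ℝ := 2 ^ d * B ^ (2 * d) + 1 with hb
  refine ⟨c * b ^ 2, d * (2 * d) * 2, fun δ hδ β hβ => ?_⟩
  -- This makes `d + d 2^r - (d/2 + δ) 2^(r+1) = d - 2δ 2^r` less than `-β - 1`, even after a union
  -- bound over at most `n^d` pairs.
  obtain ⟨r, hr⟩ : ∃ r : ℕ, (d + β + 1) / (2 * δ) < 2 ^ r :=
    pow_unbounded_of_one_lt _ (by norm_num)
  rw [div_lt_iff₀ (by positivity)] at hr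
  obtain ⟨C, hC0, hC⟩ := exists_gaussianSamples_hermiteKernel_bad_le d r
  -- At most `n^d · n` coordinates, each failing with probability of order `n^(-A)`, leave
  -- `n^(-β-1)`.
  set A : ℝ := d + 2 + β with hA
  have hA0 : 0 ≤ A := by positivity
  set E₁ : ℝ := 2 * Real.exp (A ^ 2 / 2) with hE₁
  set E₂ : ℝ := C * 2 ^ (d * 2 ^ r) with hE₂
  -- The bound `n ≥ 3` gives `log n ≥ 1`; the other lets the spare factor `n^(-1)` absorb the
  -- constants `E₁ + E₂`.
  refine ⟨max 3 ⌈E₁ + E₂⌉₊, fun n hn m hm => ?_⟩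
  have hn3 : (3 : ℝ) ≤ n := by exact_mod_cast (le_max_left _ _).trans hn
  have hnE : E₁ + E₂ ≤ n := Nat.ceil_le.mp ((le_max_right _ _).trans hn)
  have hn0 : (0 : ℝ) < n := by linarith
  have hn1 : (1 : ℝ) ≤ n := by linarith
  set L := Real.log n with hL
  have hL1 : 1 ≤ L := by
    rw [hL, Real.le_log_iff_exp_le hn0]
    linarith [Real.exp_one_lt_d9]
  set T : ℝ := (n : ℝ) ^ ((d : ℝ) / 2 + δ) with hT
  have hT0 : 0 < T := Real.rpow_pos_of_pos hn0 _
  have hmT : m * T ≤ (n : ℝ) ^ d := by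
    calc m * T ≤ (n : ℝ) ^ ((d : ℝ) / 2 - δ) * T := by gcongr
      _ = (n : ℝ) ^ (d : ℝ) := by rw [hT, ← Real.rpow_add hn0]; congr 1; ring
      _ = _ := Real.rpow_natCast _ _
  have hgood : ∀ p : Fin m → Fin n → ℝ, ¬ ((∃ i k, L ≤ |p i k|) ∨
      ∃ i j, i ≠ j ∧ T ≤ |hermiteKernel d (p i) (p j)|) → ∀ x : EuclideanSpace ℝ (Fin m),
        ‖WithLp.toLp 2 ((linearizationMatrix n d *
          (hermiteMatrix d p ⊗ₖ hermiteMatrix d p)).mulVec (tensorSquare x))‖ ^ 2 ≤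
            c * b ^ 2 * L ^ (d * (2 * d) * 2) * (n : ℝ) ^ (2 * d) * ‖x‖ ^ 4 := by
    intro p hp x
    push Not at hp
    obtain ⟨hp1, hp2⟩ := hp
    have h1 := sum_sq_le_of_hermiteKernel_le d p x hT0.le
      (fun i => hB n L hL1 (p i) fun k => (hp1 i k).le) fun i j hij => (hp2 i j hij).le
    have h2 : (n + 1 : ℝ) ^ d * (B * L ^ d) ^ (2 * d) + m * T ≤
        b * L ^ (d * (2 * d)) * (n : ℝ) ^ d := by
      have h3 : (n + 1 : ℝ) ^ d ≤ 2 ^ d * (n : ℝ) ^ d := by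
        rw [← mul_pow]
        gcongr
        linarith
      have h4 : 1 ≤ L ^ (d * (2 * d)) := one_le_pow₀ hL1
      calc _ ≤ 2 ^ d * (n : ℝ) ^ d * (B * L ^ d) ^ (2 * d) + L ^ (d * (2 * d)) * (n : ℝ) ^ d := by
            refine add_le_add (mul_le_mul_of_nonneg_right h3 (by positivity)) ?_
            exact hmT.trans (le_mul_of_one_le_left (by positivity) h4)
        _ = _ := by rw [hb, mul_pow, ← pow_mul]; ring
    refine (hc n m p x).trans ?_
    calc _ ≤ c * (b * L ^ (d * (2 * d)) * (n : ℝ) ^ d * ‖x‖ ^ 2) ^ 2 := by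
          gcongr
          exact h1.trans (mul_le_mul_of_nonneg_right h2 (sq_nonneg _))
      _ = _ := by ring
  have hmn : (m : ℝ) ≤ (n : ℝ) ^ (d : ℝ) := by
    refine hm.trans (Real.rpow_le_rpow_of_exponent_le hn1 ?_)
    have : (0 : ℝ) ≤ d := Nat.cast_nonneg d
    linarith
  have hbad1 : m * (n * (2 * Real.exp (A ^ 2 / 2 - A * L))) ≤ E₁ * (n : ℝ) ^ (-β - 1) := by
    have h1 : Real.exp (A ^ 2 / 2 - A * L) = Real.exp (A ^ 2 / 2) * (n : ℝ) ^ (-A) := by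
      rw [Real.rpow_def_of_pos hn0, ← Real.exp_add]
      congr 1
      ring
    have h2 : (n : ℝ) ^ (d : ℝ) * (n * (n : ℝ) ^ (-A)) = (n : ℝ) ^ (-β - 1) := by
      nth_rewrite 2 [← Real.rpow_one (n : ℝ)]
      rw [← Real.rpow_add hn0, ← Real.rpow_add hn0]
      congr 1
      rw [hA]
      ring
    rw [h1, ← h2, hE₁]
    calc _ ≤ (n : ℝ) ^ (d : ℝ) * (n * (2 * (Real.exp (A ^ 2 / 2) * (n : ℝ) ^ (-A)))) := by
          gcongr
      _ = _ := by ring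
  have hbad2 : m * (m * (C * (n + 1 : ℝ) ^ (d * 2 ^ r) / T ^ 2 ^ (r + 1))) ≤
      E₂ * (n : ℝ) ^ (-β - 1) := by
    have h1 : (n + 1 : ℝ) ^ (d * 2 ^ r) ≤ 2 ^ (d * 2 ^ r) * (n : ℝ) ^ (d * 2 ^ r) := by
      rw [← mul_pow]
      gcongr
      linarith
    have hm2 : (m : ℝ) * m ≤ (n : ℝ) ^ (d : ℝ) := by
      calc (m : ℝ) * m ≤ (n : ℝ) ^ ((d : ℝ) / 2 - δ) * (n : ℝ) ^ ((d : ℝ) / 2 - δ) := by gcongr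
        _ = (n : ℝ) ^ ((d : ℝ) - 2 * δ) := by rw [← Real.rpow_add hn0]; congr 1; ring
        _ ≤ _ := Real.rpow_le_rpow_of_exponent_le hn1 (by linarith)
    have h2 : (n : ℝ) ^ (d : ℝ) * ((n : ℝ) ^ (d * 2 ^ r) / T ^ 2 ^ (r + 1)) ≤
        (n : ℝ) ^ (-β - 1) := by
      rw [hT, ← Real.rpow_natCast, ← Real.rpow_natCast, ← Real.rpow_mul hn0.le,
        ← Real.rpow_sub hn0, ← Real.rpow_add hn0]
      refine Real.rpow_le_rpow_of_exponent_le hn1 ?_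
      push_cast
      rw [pow_succ]
      nlinarith
    calc _ = (m : ℝ) * m * (C * (n + 1 : ℝ) ^ (d * 2 ^ r) / T ^ 2 ^ (r + 1)) := by ring
      _ ≤ (n : ℝ) ^ (d : ℝ) * (C * (2 ^ (d * 2 ^ r) * (n : ℝ) ^ (d * 2 ^ r)) /
          T ^ 2 ^ (r + 1)) := by gcongr
      _ = E₂ * ((n : ℝ) ^ (d : ℝ) * ((n : ℝ) ^ (d * 2 ^ r) / T ^ 2 ^ (r + 1))) := by
          rw [hE₂]; ring
      _ ≤ _ := mul_le_mul_of_nonneg_left h2 (by positivity)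
  have hbad : (gaussianSamples n m).real {p | (∃ i k, L ≤ |p i k|) ∨
      ∃ i j, i ≠ j ∧ T ≤ |hermiteKernel d (p i) (p j)|} ≤ (n : ℝ) ^ (-β) := by
    refine (hC n m A L T hA0 hT0).trans ((add_le_add hbad1 hbad2).trans ?_)
    rw [← add_mul, Real.rpow_sub_one hn0.ne', mul_div_assoc', div_le_iff₀ hn0, mul_comm]
    exact mul_le_mul_of_nonneg_left hnE (Real.rpow_nonneg hn0.le _)
  have hprob : IsProbabilityMeasure (gaussianSamples n m) := by
    unfold gaussianSamples
    infer_instance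
  set S : Set (Fin m → Fin n → ℝ) := {p | (∃ i k, L ≤ |p i k|) ∨
    ∃ i j, i ≠ j ∧ T ≤ |hermiteKernel d (p i) (p j)|} with hS
  -- Subadditivity alone suffices here, so measurability of the events plays no role.
  have h1 : 1 ≤ (gaussianSamples n m).real Sᶜ + (gaussianSamples n m).real S := by
    refine le_trans (le_of_eq ?_) (measureReal_union_le Sᶜ S)
    rw [Set.compl_union_self, probReal_univ]
  have h2 := measureReal_mono (μ := gaussianSamples n m)
    (show Sᶜ ⊆ _ from fun p hp => hgood p hp)
  refine le_trans ?_ h2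
  linarith
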